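/- **Setting.** Let $\mathrm{H}$ be a real Hilbert space and $\mathbb{R}_+=[0,\infty)$. $\Gamma_0(\mathrm{H})$ is the set of functions $\mathrm{H}\to\mathbb{R}\cup\{+\infty\}$ that are not identically $+\infty$ and whose epigraph $\mathrm{Epi}(f)=\{(x,\lambda)\in \mathrm{H}\times\mathbb{R} : f(x)\le\lambda\}$ is closed and convex. For $f\in\Gamma_0(\mathrm{H})$, $\partial f(x)=\{y : \langle y,z-x\rangle\le f(z)-f(x)\ \ \forall z\in \mathrm{H}\}$. For $A:\mathrm{H}\to\mathrm{H}$ and $f\in\Gamma_0(\mathrm{H})$ put $\mathrm{prox}_{A,f}=(A+\partial f)^{-1}$, a set-valued map. For a family $(S_\tau)_{\tau>0}$ of subsets of a normed space, $\liminf S_\tau$ is the set of $x$ such that for every sequence $t_n\to0$, $t_n>0$, there are $x_n\to x$ with $x_n\in S_{t_n}$ for all large $n$; $\limsup S_\tau$ (resp. $\text{w-}\limsup S_\tau$) is the set of $x$ for which there are $t_n\to0$, $t_n>0$, and $x_n\in S_{t_n}$ with $x_n\to x$ strongly (resp. weakly). The family is PK-convergent if $\limsup S_\tau\subset\liminf S_\tau$,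 and Mosco convergent if $\text{w-}\limsup S_\tau\subset\liminf S_\tau$; the limit is then $\liminf S_\tau$. A family of set-valued maps G-converges if its graphs PK-converge (the limit map is the one whose graph is the limit); a family of extended-real-valued functions M-converges if its epigraphs Mosco converge (the limit function, with values in $\mathbb{R}\cup\{\pm\infty\}$, is the one whose epigraph is the limit). * $A:\mathbb{R}_+\times \mathrm{H}\to \mathrm{H}$ is *semi-differentiable* at $v$ if $D_sA(v)(w)=\lim_{\tau\to0^+,\,w'\to w}\frac{A(\tau,v+\tau w')-A(0,v)}{\tau}$ exists in $\mathrm{H}$ for every $w\in\mathrm{H}$. * $B:\mathbb{R}_+\times \mathrm{H}\rightrightarrows \mathrm{H}$ is *proto-differentiable* at $x$ for $v\in B(0,x)$ if the maps $w\mapsto \frac{B(\tau,x+\tau w)-v}{\tau}$, $\tau>0$, G-converge; the limit is the proto-derivative $D_pB(x|v)$. * Let $f:\mathbb{R}_+\times \mathrm{H}\to\mathbb{R}\cup\{+\infty\}$ with $f(t,\cdot)\in\Gamma_0(\mathrm{H})$ for all $t\ge0$. It is *twice epi-differentiable* at $v$ for $v_0$, where $f(t,v)\in\mathbb{R}$ for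 all $t\ge 0$ and $v_0\in\partial f(0,\cdot)(v)$, if the functions $w\mapsto\frac{f(\tau,v+\tau w)-f(\tau,v)-\tau\langle v_0,w\rangle}{\tau^2}$, $\tau>0$, M-converge; the limit is the second epi-derivative $d^2_ef(v|v_0)$. **Theorem.** Let $A:\mathbb{R}_+\times \mathrm{H}\to \mathrm{H}$ be uniformly Lipschitz continuous and uniformly strongly monotone, i.e. there are $M\ge0$ and $\alpha>0$ such that for all $t\ge0$ and $x_1,x_2\in \mathrm{H}$ $$\|A(t,x_2)-A(t,x_1)\|\le M\|x_2-x_1\|,\qquad \langle A(t,x_2)-A(t,x_1),x_2-x_1\rangle\ge\alpha\|x_2-x_1\|^2,$$ and let $f:\mathbb{R}_+\times \mathrm{H}\to\mathbb{R}\cup\{+\infty\}$ be such that $f(t,\cdot)\in\Gamma_0(\mathrm{H})$ for all $t\ge0$. Put $\mathrm{Prox}_{A,f}(t,x)=\mathrm{prox}_{A(t,\cdot),f(t,\cdot)}(x)$. Then $\mathrm{Prox}_{A,f}(t,x)$ is a singleton for all $t\ge0$ and $x\in \mathrm{H}$. Moreover, let $x\in \mathrm{H}$, $v=\mathrm{Prox}_{A,f}(0,x)$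 and $v_0=x-A(0,v)$, and assume that 1. $A$ is semi-differentiable at $v$; 2. $f$ is twice epi-differentiable at $v$ for $v_0$; 3. $d^2_ef(v|v_0)\in\Gamma_0(\mathrm{H})$. Then $\mathrm{Prox}_{A,f}$ is proto-differentiable at $x$ for $v$, with $$D_p(\mathrm{Prox}_{A,f})(x|v)=\mathrm{prox}_{D_sA(v),\,d^2_ef(v|v_0)},$$ and the right-hand side is a single-valued map on all of $\mathrm{H}$. -/

import Mathlib

open Filter Topology
open scoped NNReal Pointwise

noncomputable section

namespace SensVI

/-! ## Limits of families of sets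

A family `(S_τ)_{τ > 0}` is a function on `ℝ≥0`; its value at `τ = 0` is never used. -/

/-- `(t_n)` is a sequence of positive parameters that tends to `0`. -/
def PosToZero (t : ℕ → ℝ≥0) : Prop :=
  (∀ n, 0 < t n) ∧ Tendsto t atTop (𝓝 0)

/-- Weak convergence of a sequence in a normed space. -/
def WeakTendsto {X : Type*} [NormedAddCommGroup X] [NormedSpace ℝ X] (u : ℕ → X) (x : X) : Prop :=
  Tendsto (fun n => toWeakSpace ℝ X (u n)) atTop (𝓝 (toWeakSpace ℝ X x))

/-- The outer limit `limsup S_τ` as `τ → 0`. -/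
def outerLimit {X : Type*} [NormedAddCommGroup X] (S : ℝ≥0 → Set X) : Set X :=
  {x | ∃ t : ℕ → ℝ≥0, PosToZero t ∧ ∃ u : ℕ → X, Tendsto u atTop (𝓝 x) ∧ ∀ n, u n ∈ S (t n)}

/-- The weak-outer limit `w-limsup S_τ` as `τ → 0`. -/
def weakOuterLimit {X : Type*} [NormedAddCommGroup X] [NormedSpace ℝ X] (S : ℝ≥0 → Set X) :
    Set X :=
  {x | ∃ t : ℕ → ℝ≥0, PosToZero t ∧ ∃ u : ℕ → X, WeakTendsto u x ∧ ∀ n, u n ∈ S (t n)}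

/-- The inner limit `liminf S_τ` as `τ → 0`. -/
def innerLimit {X : Type*} [NormedAddCommGroup X] (S : ℝ≥0 → Set X) : Set X :=
  {x | ∀ t : ℕ → ℝ≥0, PosToZero t →
    ∃ u : ℕ → X, Tendsto u atTop (𝓝 x) ∧ ∃ N : ℕ, ∀ n ≥ N, u n ∈ S (t n)}

/-- Painlevé–Kuratowski convergence of `(S_τ)` as `τ → 0`. -/
def PKConvergent {X : Type*} [NormedAddCommGroup X] (S : ℝ≥0 → Set X) : Prop :=
  outerLimit S ⊆ innerLimit S

/-- The Painlevé–Kuratowski limit (meaningful when `PKConvergent S`). -/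
def pkLim {X : Type*} [NormedAddCommGroup X] (S : ℝ≥0 → Set X) : Set X :=
  innerLimit S

/-- Mosco convergence of `(S_τ)` as `τ → 0`. -/
def MoscoConvergent {X : Type*} [NormedAddCommGroup X] [NormedSpace ℝ X] (S : ℝ≥0 → Set X) :
    Prop :=
  weakOuterLimit S ⊆ innerLimit S

/-- The Mosco limit (meaningful when `MoscoConvergent S`). -/
def moscoLim {X : Type*} [NormedAddCommGroup X] (S : ℝ≥0 → Set X) : Set X :=
  innerLimit S

/-! ## Set-valued maps -/

/-- The graph of a set-valued map. -/
def graph {H : Type*} (B : H → Set H) : Set (H × H) :=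
  {p | p.2 ∈ B p.1}

/-- The inverse of a set-valued map. -/
def invMap {H : Type*} (B : H → Set H) : H → Set H :=
  fun y => {x | y ∈ B x}

/-- Graphical convergence of a family of set-valued maps as `τ → 0`. -/
def GConvergent {H : Type*} [NormedAddCommGroup H] (B : ℝ≥0 → H → Set H) : Prop :=
  PKConvergent (fun τ => graph (B τ))

/-- The graphical limit: the set-valued map whose graph is the limit of the graphs. -/
def gLim {H : Type*} [NormedAddCommGroup H] (B : ℝ≥0 → H → Set H) : H → Set H :=
  fun x => {y | (x, y) ∈ pkLim (fun τ => graph (B τ))}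

/-! ## Extended-real-valued functions -/

/-- The epigraph, a subset of `H × ℝ`. -/
def epi {H : Type*} (f : H → EReal) : Set (H × ℝ) :=
  {p | f p.1 ≤ (p.2 : EReal)}

/-- M-convergence of a family of functions as `τ → 0`: Mosco convergence of the epigraphs. -/
def MConvergent {H : Type*} [NormedAddCommGroup H] [NormedSpace ℝ H] (f : ℝ≥0 → H → EReal) :
    Prop :=
  MoscoConvergent (fun τ => epi (f τ))

/-- The epi-limit: the function whose epigraph is the Mosco limit of the epigraphs
(see `epi_eLim`). -/
def eLim {H : Type*} [NormedAddCommGroup H] (f : ℝ≥0 → H → EReal) : H → EReal :=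
  fun z => ⨅ r : ℝ, ⨅ _ : (z, r) ∈ moscoLim (fun τ => epi (f τ)), (r : EReal)

theorem mem_innerLimit_of_forall_dist {X : Type*} [NormedAddCommGroup X] (S : ℝ≥0 → Set X)
    (x : X) (h : ∀ ε > 0, ∃ y ∈ innerLimit S, dist y x < ε) : x ∈ innerLimit S := by
  intro t ht
  have key : ∀ ε > 0, ∀ᶠ n in atTop, ∃ p ∈ S (t n), dist p x < ε := by
    intro ε hε
    obtain ⟨y, hy, hyx⟩ := h (ε / 2) (half_pos hε)
    obtain ⟨u, hu, N, hN⟩ := hy t ht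
    filter_upwards [(Metric.tendsto_nhds.1 hu) (ε / 2) (half_pos hε), eventually_ge_atTop N]
      with n h1 h2
    exact ⟨u n, hN n h2, by linarith [dist_triangle (u n) y x]⟩
  have hex : ∀ n, ∃ p : X, (S (t n)).Nonempty →
      p ∈ S (t n) ∧ dist x p < Metric.infDist x (S (t n)) + 1 / ((n : ℝ) + 1) := by
    intro n
    by_cases hne : (S (t n)).Nonempty
    · obtain ⟨p, hp, hd⟩ := (Metric.infDist_lt_iff hne).1
        (lt_add_of_pos_right (Metric.infDist x (S (t n))) (Nat.one_div_pos_of_nat (α := ℝ) (n := n)))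
      exact ⟨p, fun _ => ⟨hp, hd⟩⟩
    · exact ⟨x, fun h' => absurd h' hne⟩
  choose u hu using hex
  refine ⟨u, ?_, ?_⟩
  · rw [Metric.tendsto_nhds]
    intro ε hε
    have h1 := (tendsto_one_div_add_atTop_nhds_zero_nat (𝕜 := ℝ)).eventually
      (gt_mem_nhds (half_pos hε))
    filter_upwards [key (ε / 2) (half_pos hε), h1] with n hn hn1
    obtain ⟨p, hp, hd⟩ := hn
    have h2 := (hu n ⟨p, hp⟩).2
    have h3 := Metric.infDist_le_dist_of_mem (x := x) hp
    rw [dist_comm] at hd ⊢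
    linarith
  · obtain ⟨N, hN⟩ := eventually_atTop.1 (key 1 one_pos)
    exact ⟨N, fun n hn => (hu n (let ⟨p, hp, _⟩ := hN n hn; ⟨p, hp⟩)).1⟩

theorem epi_eLim {H : Type*} [NormedAddCommGroup H] (f : ℝ≥0 → H → EReal) :
    epi (eLim f) = moscoLim (fun τ => epi (f τ)) := by
  ext ⟨z, r⟩
  constructor
  · intro h
    refine mem_innerLimit_of_forall_dist _ _ fun ε hε => ?_
    have h' : eLim f z < ((r + ε / 2 : ℝ) : EReal) :=
      lt_of_le_of_lt h (EReal.coe_lt_coe_iff.2 (by linarith))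
    simp only [eLim, iInf_lt_iff] at h'
    obtain ⟨s, hs, hsr⟩ := h'
    have hsr' : s < r + ε / 2 := EReal.coe_lt_coe_iff.1 hsr
    refine ⟨(z, r + ε / 2), ?_, ?_⟩
    · intro t ht
      obtain ⟨u, hu, N, hN⟩ := hs t ht
      refine ⟨fun n => u n + (0, r + ε / 2 - s), ?_, N, fun n hn => ?_⟩
      · simpa using hu.add_const ((0, r + ε / 2 - s) : H × ℝ)
      · have h1 : f (t n) (u n).1 ≤ ((u n).2 : EReal) := hN n hn
        have h2 : ((u n).2 : EReal) ≤ (((u n).2 + (r + ε / 2 - s) : ℝ) : EReal) :=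
          EReal.coe_le_coe_iff.2 (by linarith)
        simpa [epi] using h1.trans h2
    · rw [dist_prod_same_left, Real.dist_eq, add_sub_cancel_left, abs_of_pos (half_pos hε)]
      linarith
  · intro h
    have h' : eLim f z ≤ (r : EReal) := iInf_le_of_le r (iInf_le_of_le h le_rfl)
    exact h'

/-! ## Convex analysis -/

section Hilbert

variable {H : Type*} [NormedAddCommGroup H] [InnerProductSpace ℝ H]

/-- `Γ₀(H)`: proper lower semicontinuous convex functions with values in `ℝ ∪ {+∞}`. -/
structure IsGamma0 (f : H → EReal) : Prop where
  ne_bot : ∀ x, f x ≠ ⊥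
  proper : ∃ x, f x ≠ ⊤
  lsc : IsClosed (epi f)
  convex : Convex ℝ (epi f)

/-- `Γ₀(·, H)`. -/
def IsParamGamma0 (f : ℝ≥0 → H → EReal) : Prop :=
  ∀ t, IsGamma0 (f t)

/-- The subdifferential operator. In `EReal` one has `a - ⊤ = ⊥`, so that `∂f(x) = ∅` when
`f x = +∞`. -/
def subdiff (f : H → EReal) : H → Set H :=
  fun x => {y | ∀ z, ((inner ℝ y (z - x) : ℝ) : EReal) ≤ f z - f x}

/-- The generalized proximity operator `prox_{A,f} = (A + ∂f)⁻¹`. -/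
def prox (A : H → H) (f : H → EReal) : H → Set H :=
  invMap (fun y => {A y} + subdiff f y)

/-- `Prox_{A,f}(t, x) = prox_{A(t,·), f(t,·)}(x)`. -/
def Prox (A : ℝ≥0 → H → H) (f : ℝ≥0 → H → EReal) : ℝ≥0 → H → Set H :=
  fun t => prox (A t) (f t)

/-- Uniform Lipschitz continuity of a parameterized map. -/
def UniformlyLipschitz (A : ℝ≥0 → H → H) : Prop :=
  ∃ M : ℝ, 0 ≤ M ∧ ∀ t x₁ x₂, ‖A t x₂ - A t x₁‖ ≤ M * ‖x₂ - x₁‖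

/-- Uniform strong monotonicity of a parameterized map. -/
def UniformlyStronglyMonotone (A : ℝ≥0 → H → H) : Prop :=
  ∃ α : ℝ, 0 < α ∧ ∀ t x₁ x₂, α * ‖x₂ - x₁‖ ^ 2 ≤ inner ℝ (A t x₂ - A t x₁) (x₂ - x₁)

/-! ## Generalized differentiability -/

/-- The difference quotient `(A(τ, x + τ w') - A(0, x)) / τ` as a function of `(τ, w')`. -/
def semiQuot (A : ℝ≥0 → H → H) (x : H) : ℝ≥0 × H → H :=
  fun p => (p.1 : ℝ)⁻¹ • (A p.1 (x + (p.1 : ℝ) • p.2) - A 0 x)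

/-- Semi-differentiability at `x`: the limit of the quotient as `τ → 0`, `τ > 0`, `w' → w`
exists for every `w`. -/
def SemiDifferentiableAt (A : ℝ≥0 → H → H) (x : H) : Prop :=
  ∀ w, ∃ L, Tendsto (semiQuot A x) (𝓝[>] 0 ×ˢ 𝓝 w) (𝓝 L)

/-- The semi-derivative `D_s A(x)`. -/
def semiDeriv (A : ℝ≥0 → H → H) (x : H) : H → H :=
  fun w => limUnder (𝓝[>] 0 ×ˢ 𝓝 w) (semiQuot A x)

/-- The set-valued difference quotient
`Δ_τ B(x|v)(w) = (B(τ, x + τ w) - v) / τ`. -/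
def protoQuot (B : ℝ≥0 → H → Set H) (x v : H) : ℝ≥0 → H → Set H :=
  fun τ w => (fun y => (τ : ℝ)⁻¹ • (y - v)) '' B τ (x + (τ : ℝ) • w)

/-- Proto-differentiability of `B` at `x` for `v ∈ B(0, x)`. -/
def ProtoDifferentiableAt (B : ℝ≥0 → H → Set H) (x v : H) : Prop :=
  v ∈ B 0 x ∧ GConvergent (protoQuot B x v)

/-- The proto-derivative `D_p B(x|v)`. -/
def protoDeriv (B : ℝ≥0 → H → Set H) (x v : H) : H → Set H :=
  gLim (protoQuot B x v)

/-- The second-order difference quotient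
`Δ²_τ f(x|v)(w) = (f(τ, x + τ w) - f(τ, x) - τ ⟪v, w⟫) / τ²`. -/
def secondQuot (f : ℝ≥0 → H → EReal) (x v : H) : ℝ≥0 → H → EReal :=
  fun τ w => (f τ (x + (τ : ℝ) • w) - f τ x - (((τ : ℝ) * inner ℝ v w : ℝ) : EReal)) /
    (((τ : ℝ) ^ 2 : ℝ) : EReal)

/-- Twice epi-differentiability of `f` at `x` for `v ∈ ∂f(0, x)`, where `f(t, x)` is real for
every `t ≥ 0`. -/
def TwiceEpiDifferentiableAt (f : ℝ≥0 → H → EReal) (x v : H) : Prop :=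
  (∀ t, ∃ r : ℝ, f t x = (r : EReal)) ∧ v ∈ subdiff (f 0) x ∧ MConvergent (secondQuot f x v)

/-- The second epi-derivative `d²_e f(x|v)`. -/
def secondEpiDeriv (f : ℝ≥0 → H → EReal) (x v : H) : H → EReal :=
  eLim (secondQuot f x v)

end Hilbert

end SensVI

end

open SensVI

namespace SensVI

/-! Rescaling the variational inequality behind `Prox` shows that its difference quotient at `w`
again solves such an inequality, with operator `semiQuot A v` and function `secondQuot f v (x - A 0
v)` (`exists_variational_of_mem_protoQuot`). So the theorem is a stability statement for generalized
proximal points under Mosco convergence.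

The core is `exists_subseq_tendsto_of_variational`. Strong monotonicity and a linear minorant
uniform in `τ` bound the solutions. A weak cluster point lies in the limit epigraph by Mosco
convergence. Testing the approximate inequalities at a recovery sequence of the limit solution, and
the limit inequality at the cluster point, squeezes the distance to the recovery sequence to zero;
hence the convergence is strong.

This gives convergence of the quotients at each fixed `w`. They are Lipschitz with constant `1/α`
for every `τ`, which upgrades pointwise to graphical convergence. Existence in
`IsGamma0.existsUnique_mem_prox` comes from the Banach fixed point theorem applied to a
forward-backward map. -/

/-! ### Weak convergence and weak compactness -/

theorem weakTendsto_of_forall_dual {X : Type*} [NormedAddCommGroup X] [NormedSpace ℝ X]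
    {u : ℕ → X} {x : X} (h : ∀ φ : StrongDual ℝ X, Tendsto (fun n => φ (u n)) atTop (𝓝 (φ x))) :
    WeakTendsto u x := by
  unfold WeakTendsto
  refine (WeakBilin.tendsto_iff_forall_eval_tendsto (topDualPairing ℝ X).flip ?_).2 h
  intro a b hab
  exact (SeparatingDual.eq_iff_forall_dual_eq (R := ℝ)).2 fun g => LinearMap.congr_fun hab g

section Hilbert

variable {H : Type*} [NormedAddCommGroup H] [InnerProductSpace ℝ H]

theorem weakTendsto_prodMk [CompleteSpace H] {z : ℕ → H} {x : H} {s : ℕ → ℝ} {r : ℝ}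
    (hz : ∀ y, Tendsto (fun n => inner ℝ y (z n)) atTop (𝓝 (inner ℝ y x)))
    (hs : Tendsto s atTop (𝓝 r)) : WeakTendsto (fun n => (z n, s n)) (x, r) := by
  refine weakTendsto_of_forall_dual fun φ => ?_
  have key : ∀ (a : H) (b : ℝ), φ (a, b) =
      inner ℝ ((InnerProductSpace.toDual ℝ H).symm (φ.comp (ContinuousLinearMap.inl ℝ H ℝ))) a
        + φ.comp (ContinuousLinearMap.inr ℝ H ℝ) b := by
    intro a b
    rw [InnerProductSpace.toDual_symm_apply]
    simp only [ContinuousLinearMap.comp_apply, ContinuousLinearMap.inl_apply,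
      ContinuousLinearMap.inr_apply, ← map_add]
    simp
  simp only [key]
  exact (hz _).add (((ContinuousLinearMap.continuous _).tendsto r).comp hs)

/-- Bounded sequences in a Hilbert space have weakly convergent subsequences. -/
theorem exists_subseq_inner_tendsto [CompleteSpace H] {z : ℕ → H} {C : ℝ} (hz : ∀ n, ‖z n‖ ≤ C) :
    ∃ (x : H) (φ : ℕ → ℕ), StrictMono φ ∧
      ∀ y, Tendsto (fun n => inner ℝ y (z (φ n))) atTop (𝓝 (inner ℝ y x)) := by
  -- Sequential Banach–Alaoglu needs separability, so work in the closed span of the sequence; other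
  -- test vectors are handled by projecting onto it.
  set K : Submodule ℝ H := (Submodule.span ℝ (Set.range z)).topologicalClosure with hK
  have hzK : ∀ n, z n ∈ K := fun n =>
    Submodule.le_topologicalClosure _ (Submodule.subset_span ⟨n, rfl⟩)
  have hclosed : IsClosed (K : Set H) := Submodule.isClosed_topologicalClosure _
  have : CompleteSpace K := hclosed.completeSpace_coe
  have hsep : TopologicalSpace.IsSeparable (K : Set H) := by
    rw [hK, Submodule.topologicalClosure_coe]
    exact ((Set.countable_range z).isSeparable.span).closure
  have : TopologicalSpace.SeparableSpace K := hsep.separableSpace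
  let D : ℕ → WeakDual ℝ K := fun n =>
    StrongDual.toWeakDual (InnerProductSpace.toDual ℝ K ⟨z n, hzK n⟩)
  obtain ⟨a, -, φ, hφ, ha⟩ := WeakDual.isSeqCompact_closedBall ℝ K (0 : StrongDual ℝ K) C
    (x := D) (fun n => by
      simp only [D, Set.mem_preimage, mem_closedBall_zero_iff]
      rw [StrongDual.toStrongDual_toWeakDual, LinearIsometryEquiv.norm_map]
      exact hz n)
  refine ⟨((InnerProductSpace.toDual ℝ K).symm (WeakDual.toStrongDual a) : K), φ, hφ, fun y => ?_⟩
  have h1 : Tendsto (fun n => D (φ n) (K.orthogonalProjectionOnto y)) atTop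
      (𝓝 (a (K.orthogonalProjectionOnto y))) :=
    ((WeakDual.eval_continuous (K.orthogonalProjectionOnto y)).tendsto a).comp ha
  have h2 : ∀ k : K, inner ℝ y (k : H) = inner ℝ k (K.orthogonalProjectionOnto y) := fun k => by
    rw [real_inner_comm, Submodule.coe_inner]
    exact (Submodule.inner_orthogonalProjectionOnto_eq_of_mem_left k y).symm
  rw [h2, InnerProductSpace.toDual_symm_apply]
  refine h1.congr fun n => ?_
  exact (h2 ⟨z (φ n), hzK _⟩).symm

/-- A weakly convergent bounded sequence tested against a strongly convergent one. -/
theorem tendsto_inner_of_weak {z a : ℕ → H} {x b : H} {C : ℝ} (hC : ∀ n, ‖z n‖ ≤ C)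
    (hz : ∀ y, Tendsto (fun n => inner ℝ y (z n)) atTop (𝓝 (inner ℝ y x)))
    (ha : Tendsto a atTop (𝓝 b)) :
    Tendsto (fun n => inner ℝ (a n) (z n)) atTop (𝓝 (inner ℝ b x)) := by
  have h1 : Tendsto (fun n => inner ℝ (a n - b) (z n)) atTop (𝓝 0) := by
    have h2 : Tendsto (fun n => ‖a n - b‖ * C) atTop (𝓝 0) := by
      simpa using (tendsto_iff_norm_sub_tendsto_zero.1 ha).mul_const C
    exact squeeze_zero_norm (fun n => (norm_inner_le_norm _ _).trans
      (mul_le_mul_of_nonneg_left (hC n) (norm_nonneg _))) h2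
  simpa [inner_sub_left] using h1.add (hz b)

end Hilbert

/-! ### Subgradients and minorants -/

section ConvexAnalysis

variable {H : Type*} [NormedAddCommGroup H] [InnerProductSpace ℝ H]

/-- Quantifying over points of the epigraph replaces `EReal` subtraction by real inequalities. -/
theorem mem_subdiff_iff {f : H → EReal} (hf : ∀ x, f x ≠ ⊥) {x y : H} :
    y ∈ subdiff f x ↔
      ∃ r : ℝ, f x = r ∧ ∀ z (s : ℝ), f z ≤ s → r + inner ℝ y (z - x) ≤ s := by
  constructor
  · intro h
    have htop : f x ≠ ⊤ := by
      intro hx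
      have h1 := h x
      rw [hx, EReal.sub_top, le_bot_iff] at h1
      exact EReal.coe_ne_bot _ h1
    obtain ⟨r, hr⟩ : ∃ r : ℝ, f x = r := ⟨_, (EReal.coe_toReal htop (hf x)).symm⟩
    refine ⟨r, hr, fun z s hs => ?_⟩
    have h1 := (h z).trans (EReal.sub_le_sub hs le_rfl)
    rw [hr, ← EReal.coe_sub, EReal.coe_le_coe_iff] at h1
    linarith
  · rintro ⟨r, hr, h⟩ z
    rw [hr]
    by_cases hz : f z = ⊤
    · rw [hz, EReal.top_sub_coe]; exact le_top
    · obtain ⟨s, hs⟩ : ∃ s : ℝ, f z = s := ⟨_, (EReal.coe_toReal hz (hf z)).symm⟩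
      have := h z s hs.le
      rw [hs, ← EReal.coe_sub, EReal.coe_le_coe_iff]
      linarith

theorem IsGamma0.mem_prox_iff {f : H → EReal} (hf : IsGamma0 f) {A : H → H} {x y : H} :
    y ∈ prox A f x ↔
      ∃ r : ℝ, f y = r ∧ ∀ z (s : ℝ), f z ≤ s → r + inner ℝ (x - A y) (z - y) ≤ s := by
  rw [← mem_subdiff_iff hf.ne_bot]
  simp only [prox, invMap, Set.singleton_add, Set.mem_ofPred_eq, Set.mem_image]
  constructor
  · rintro ⟨u, hu, rfl⟩
    simpa using hu
  · intro h
    exact ⟨_, h, by abel⟩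

/-- Two solutions `y₁ ∈ prox_{A,f}(x₁)`, `y₂ ∈ prox_{A,f}(x₂)` satisfy the monotonicity
inequality. -/
theorem IsGamma0.inner_nonneg_of_mem_prox {f : H → EReal} (hf : IsGamma0 f) {A B : H → H}
    {x₁ x₂ y₁ y₂ : H} (h₁ : y₁ ∈ prox A f x₁) (h₂ : y₂ ∈ prox B f x₂) :
    0 ≤ inner ℝ ((x₁ - A y₁) - (x₂ - B y₂)) (y₁ - y₂) := by
  obtain ⟨r, hr, hr'⟩ := hf.mem_prox_iff.1 h₁
  obtain ⟨s, hs, hs'⟩ := hf.mem_prox_iff.1 h₂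
  have h3 := hr' _ _ hs.le
  have h4 := hs' _ _ hr.le
  rw [← neg_sub y₁ y₂, inner_neg_right] at h3
  rw [inner_sub_left]
  linarith

/-- Closedness bounds `f` below near a point of its domain. A steep descent far away would, by
convexity along the segment, violate that local bound; no separation theorem is needed. -/
theorem IsGamma0.exists_linear_lower_bound {f : H → EReal} (hf : IsGamma0 f) :
    ∃ C : ℝ, 0 ≤ C ∧ ∀ z (s : ℝ), f z ≤ s → -(C * (‖z‖ + 1)) ≤ s := by
  obtain ⟨x, hx⟩ := hf.proper
  obtain ⟨r, hr⟩ : ∃ r : ℝ, f x = r := ⟨_, (EReal.coe_toReal hx (hf.ne_bot x)).symm⟩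
  have hmem : (x, r - 1) ∈ (epi f)ᶜ := by
    simp only [epi, Set.mem_compl_iff, Set.mem_ofPred_eq, hr, EReal.coe_le_coe_iff]
    linarith
  obtain ⟨δ, hδ, hball⟩ := Metric.isOpen_iff.1 hf.lsc.isOpen_compl _ hmem
  have hlow : ∀ z (s : ℝ), f z ≤ s → ‖z - x‖ < δ → r - 1 ≤ s := by
    intro z s hzs hz
    by_contra! hlt
    refine hball (show (z, r - 1) ∈ Metric.ball (x, r - 1) δ from ?_)
      (show f z ≤ _ from hzs.trans (EReal.coe_le_coe_iff.2 hlt.le))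
    rw [Metric.mem_ball, dist_prod_same_right, dist_eq_norm]
    exact hz
  have key : ∀ z (s : ℝ), f z ≤ s → r - 1 - 2 / δ * ‖z - x‖ ≤ s := by
    intro z s hzs
    by_cases hz : ‖z - x‖ < δ
    · have := hlow z s hzs hz
      have : 0 ≤ 2 / δ * ‖z - x‖ := by positivity
      linarith
    · push Not at hz
      have hn : 0 < ‖z - x‖ := hδ.trans_le hz
      -- This `l` puts the convex combination at distance `δ / 2` from `x`.
      set l : ℝ := δ / (2 * ‖z - x‖) with hl
      have hl0 : 0 < l := by positivity
      have hl1 : l ≤ 1 := by rw [hl, div_le_one (by positivity)]; linarith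
      have hc := hf.convex (show (x, r) ∈ epi f from hr.le) (show (z, s) ∈ epi f from hzs)
        (sub_nonneg.2 hl1) hl0.le (by ring)
      have hc' : f ((1 - l) • x + l • z) ≤ (((1 - l) * r + l * s : ℝ) : EReal) := hc
      have h1 := hlow _ _ hc' (by
        rw [show (1 - l) • x + l • z - x = l • (z - x) by module, norm_smul, Real.norm_eq_abs,
          abs_of_pos hl0, hl]
        field_simp
        linarith)
      have h2 : -1 ≤ l * (s - r) := by linarith
      have h3 : l * (2 / δ * ‖z - x‖) = 1 := by rw [hl]; field_simp
      have h4 : 0 ≤ l * (s - r + 2 / δ * ‖z - x‖) := by rw [mul_add, h3]; linarith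
      have := nonneg_of_mul_nonneg_right h4 hl0
      linarith
  refine ⟨|r - 1| + 2 / δ * (‖x‖ + 1), by positivity, fun z s hzs => ?_⟩
  have h1 := key z s hzs
  have h2 : 2 / δ * ‖z - x‖ ≤ 2 / δ * (‖z‖ + ‖x‖) :=
    mul_le_mul_of_nonneg_left (norm_sub_le _ _) (by positivity)
  have h3 := neg_abs_le (r - 1)
  have h4 : 0 ≤ |r - 1| * ‖z‖ := by positivity
  have h5 : 0 ≤ 2 / δ * (‖x‖ * ‖z‖ + 1) := by positivity
  nlinarith

end ConvexAnalysis

/-! ### Existence and uniqueness of generalized proximal points -/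

section Existence

variable {H : Type*} [NormedAddCommGroup H] [InnerProductSpace ℝ H]

theorem IsGamma0.bddBelow_regularized {f : H → EReal} (hf : IsGamma0 f) {c : ℝ} (hc : 0 < c)
    (a : H) : BddBelow ((fun q : H × ℝ => q.2 + c / 2 * ‖q.1 - a‖ ^ 2) '' epi f) := by
  obtain ⟨C, hC, hb⟩ := hf.exists_linear_lower_bound
  refine ⟨-(C * (‖a‖ + 1)) - C ^ 2 / (2 * c), ?_⟩
  rintro _ ⟨⟨z, s⟩, hzs, rfl⟩
  have h1 := hb z s hzs
  have h2 : C * ‖z‖ ≤ C * (‖z - a‖ + ‖a‖) :=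
    mul_le_mul_of_nonneg_left (by simpa using norm_add_le (z - a) a) hC
  have h3 : c / 2 * ‖z - a‖ ^ 2 - C * ‖z - a‖ + C ^ 2 / (2 * c)
      = c / 2 * (‖z - a‖ - C / c) ^ 2 := by
    field_simp
    ring
  have h4 : 0 ≤ c / 2 * (‖z - a‖ - C / c) ^ 2 := by positivity
  change _ ≤ s + c / 2 * ‖z - a‖ ^ 2
  linarith

theorem nonneg_of_forall_add_mul_nonneg {D K : ℝ} (h : ∀ l : ℝ, 0 < l → l ≤ 1 → 0 ≤ D + l * K) :
    0 ≤ D := by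
  have h1 : Tendsto (fun l : ℝ => D + l * K) (𝓝[>] 0) (𝓝 (D + 0 * K)) :=
    ((by fun_prop : Continuous fun l : ℝ => D + l * K).tendsto 0).mono_left nhdsWithin_le_nhds
  rw [zero_mul, add_zero] at h1
  refine ge_of_tendsto h1 ?_
  filter_upwards [Ioc_mem_nhdsGT (zero_lt_one' ℝ)] with l hl using h l hl.1 hl.2

/-- Existence of the proximal point: the regularized function attains its minimum. -/
theorem IsGamma0.exists_mem_prox_smul [CompleteSpace H] {f : H → EReal} (hf : IsGamma0 f) {c : ℝ}
    (hc : 0 < c) (a : H) : ∃ p, p ∈ prox (fun y => c • y) f (c • a) := by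
  set J : H × ℝ → ℝ := fun q => q.2 + c / 2 * ‖q.1 - a‖ ^ 2 with hJ
  have hbdd : BddBelow (J '' epi f) := hf.bddBelow_regularized hc a
  have hne : (J '' epi f).Nonempty := by
    obtain ⟨x, hx⟩ := hf.proper
    exact ⟨_, (x, (f x).toReal), (EReal.coe_toReal hx (hf.ne_bot x)).ge, rfl⟩
  set m := sInf (J '' epi f) with hm
  have hmin : ∀ q ∈ epi f, m ≤ J q := fun q hq => csInf_le hbdd ⟨q, hq, rfl⟩
  have hseq : ∀ n : ℕ, ∃ q ∈ epi f, J q < m + 1 / ((n : ℝ) + 1) := by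
    intro n
    obtain ⟨_, ⟨q, hq, rfl⟩, hlt⟩ := exists_lt_of_csInf_lt hne
      (lt_add_of_pos_right m (Nat.one_div_pos_of_nat (α := ℝ) (n := n)))
    exact ⟨q, hq, hlt⟩
  choose q hq hqlt using hseq
  -- The parallelogram law at the midpoint: the quadratic term forces minimizing sequences to be
  -- Cauchy.
  have hmid : ∀ q₁ ∈ epi f, ∀ q₂ ∈ epi f,
      c / 8 * ‖q₁.1 - q₂.1‖ ^ 2 ≤ (J q₁ + J q₂) / 2 - m := by
    intro q₁ h₁ q₂ h₂
    have h3 := hmin _ (hf.convex h₁ h₂ (by norm_num : (0 : ℝ) ≤ 1 / 2)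
      (by norm_num : (0 : ℝ) ≤ 1 / 2) (by norm_num))
    simp only [hJ, Prod.fst_add, Prod.snd_add, Prod.smul_fst, Prod.smul_snd, smul_eq_mul] at h3 ⊢
    have h4 := parallelogram_law_with_norm ℝ (q₁.1 - a) (q₂.1 - a)
    rw [show q₁.1 - a - (q₂.1 - a) = q₁.1 - q₂.1 by abel] at h4
    have h5 : ‖(1 / 2 : ℝ) • q₁.1 + (1 / 2 : ℝ) • q₂.1 - a‖ ^ 2
        = 1 / 4 * (‖q₁.1 - a + (q₂.1 - a)‖ * ‖q₁.1 - a + (q₂.1 - a)‖) := by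
      rw [show (1 / 2 : ℝ) • q₁.1 + (1 / 2 : ℝ) • q₂.1 - a
        = (1 / 2 : ℝ) • (q₁.1 - a + (q₂.1 - a)) by module, norm_smul]
      norm_num
      ring
    rw [h5] at h3
    linear_combination h3 + c / 8 * h4
  have hcauchy : CauchySeq (fun n => (q n).1) := by
    refine cauchySeq_of_le_tendsto_0 (fun N : ℕ => √(8 / c * (1 / ((N : ℝ) + 1)))) ?_ ?_
    · intro n k N hn hk
      rw [dist_eq_norm]
      refine Real.le_sqrt_of_sq_le ?_
      have h1 := hmid _ (hq n) _ (hq k)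
      have h2 := hqlt n
      have h3 := hqlt k
      have h4 := Nat.one_div_le_one_div (α := ℝ) hn
      have h5 := Nat.one_div_le_one_div (α := ℝ) hk
      have h6 : c / 8 * ‖(q n).1 - (q k).1‖ ^ 2 ≤ 1 / ((N : ℝ) + 1) := by linarith
      rw [show ‖(q n).1 - (q k).1‖ ^ 2 = 8 / c * (c / 8 * ‖(q n).1 - (q k).1‖ ^ 2) by field_simp]
      exact mul_le_mul_of_nonneg_left h6 (by positivity)
    · have := ((tendsto_one_div_add_atTop_nhds_zero_nat (𝕜 := ℝ)).const_mul (8 / c)).sqrt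
      simpa using this
  obtain ⟨p, hp⟩ := cauchySeq_tendsto_of_complete hcauchy
  have hJm : Tendsto (fun n => J (q n)) atTop (𝓝 m) := by
    refine tendsto_of_tendsto_of_tendsto_of_le_of_le tendsto_const_nhds ?_
      (fun n => hmin _ (hq n)) (fun n => (hqlt n).le)
    simpa using (tendsto_one_div_add_atTop_nhds_zero_nat (𝕜 := ℝ)).const_add m
  set r := m - c / 2 * ‖p - a‖ ^ 2 with hr
  have hq2 : Tendsto (fun n => (q n).2) atTop (𝓝 r) := by
    refine (hJm.sub ((((hp.sub_const a).norm).pow 2).const_mul (c / 2))).congr fun n => ?_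
    simp [hJ]
  have hpr : (p, r) ∈ epi f := hf.lsc.mem_of_tendsto (hp.prodMk_nhds hq2) (Eventually.of_forall hq)
  have hpr' : f p ≤ r := hpr
  have hfp : f p = r := by
    have htop : f p ≠ ⊤ := fun h => by
      rw [h, top_le_iff] at hpr'
      exact EReal.coe_ne_top _ hpr'
    obtain ⟨r', hr'⟩ : ∃ r' : ℝ, f p = r' := ⟨_, (EReal.coe_toReal htop (hf.ne_bot p)).symm⟩
    have h1 : m ≤ r' + c / 2 * ‖p - a‖ ^ 2 := hmin (p, r') hr'.le
    rw [hr'] at hpr' ⊢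
    exact le_antisymm hpr' (EReal.coe_le_coe_iff.2 (by linarith))
  refine ⟨p, hf.mem_prox_iff.2 ⟨r, hfp, fun z s hzs => ?_⟩⟩
  -- First-order optimality: compare `p` with `p + l • (z - p)`, divide by `l` and let `l` tend to
  -- `0`.
  have hD : 0 ≤ s - r - inner ℝ (c • a - c • p) (z - p) := by
    refine nonneg_of_forall_add_mul_nonneg (K := c / 2 * ‖z - p‖ ^ 2) fun l hl hl1 => ?_
    have h1 := hmin _ (hf.convex hpr (show (z, s) ∈ epi f from hzs) (sub_nonneg.2 hl1) hl.le
      (by ring))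
    simp only [hJ, Prod.fst_add, Prod.snd_add, Prod.smul_fst, Prod.smul_snd, smul_eq_mul] at h1
    rw [show (1 - l) • p + l • z - a = (p - a) + l • (z - p) by module, norm_add_sq_real,
      norm_smul, inner_smul_right, Real.norm_eq_abs, mul_pow, sq_abs] at h1
    have h2 : inner ℝ (c • a - c • p) (z - p) = -(c * inner ℝ (p - a) (z - p)) := by
      rw [show c • a - c • p = (-c) • (p - a) by module, real_inner_smul_left]
      ring
    rw [h2]
    refine nonneg_of_mul_nonneg_right (a := l) ?_ hl
    linear_combination h1 + hr
  linarith

/-- Monotonicity of the subdifferential, strong monotonicity of `A` and Cauchy–Schwarz. It serves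
both for uniqueness and for the equi-Lipschitz bound on the quotients. -/
theorem IsGamma0.norm_sub_le_of_mem_prox {f : H → EReal} (hf : IsGamma0 f) {A : H → H} {α : ℝ}
    (hA : ∀ x₁ x₂, α * ‖x₂ - x₁‖ ^ 2 ≤ inner ℝ (A x₂ - A x₁) (x₂ - x₁))
    {x₁ x₂ y₁ y₂ : H} (h₁ : y₁ ∈ prox A f x₁) (h₂ : y₂ ∈ prox A f x₂) :
    α * ‖y₁ - y₂‖ ≤ ‖x₁ - x₂‖ := by
  have h3 := hf.inner_nonneg_of_mem_prox h₁ h₂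
  have h4 := hA y₂ y₁
  rw [show x₁ - A y₁ - (x₂ - A y₂) = (x₁ - x₂) - (A y₁ - A y₂) by abel, inner_sub_left] at h3
  have h5 := real_inner_le_norm (x₁ - x₂) (y₁ - y₂)
  rcases (norm_nonneg (y₁ - y₂)).eq_or_lt with h | h
  · rw [← h, mul_zero]; exact norm_nonneg _
  · exact le_of_mul_le_mul_right (by linarith) h

/-- The generalized proximity operator of a Lipschitz continuous strongly monotone operator and a
function of `Γ₀(H)` is single-valued. -/
theorem IsGamma0.existsUnique_mem_prox [CompleteSpace H] {f : H → EReal} (hf : IsGamma0 f)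
    {A : H → H} {M α : ℝ} (hM : ∀ x₁ x₂, ‖A x₂ - A x₁‖ ≤ M * ‖x₂ - x₁‖) (hα : 0 < α)
    (hA : ∀ x₁ x₂, α * ‖x₂ - x₁‖ ^ 2 ≤ inner ℝ (A x₂ - A x₁) (x₂ - x₁)) (x : H) :
    ∃! y, y ∈ prox A f x := by
  refine existsUnique_of_exists_of_unique ?_ fun y₁ y₂ h₁ h₂ => ?_
  swap
  · have h := hf.norm_sub_le_of_mem_prox hA h₁ h₂
    rw [sub_self, norm_zero] at h
    exact sub_eq_zero.1 (norm_le_zero_iff.1 (nonpos_of_mul_nonpos_right h hα))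
  -- The forward step has squared Lipschitz constant at most `1 - 2ρα + ρ²M²`. The `M ^ 2` ensures
  -- `ρM² ≤ α`, so this is at most `1 - ρα`; the `α ^ 2` keeps `1 - ρα` nonnegative.
  set ρ : ℝ := α / (M ^ 2 + α ^ 2 + 1) with hρ
  have hρ0 : 0 < ρ := by positivity
  have hρM : ρ * (M ^ 2 + α ^ 2 + 1) = α := by rw [hρ]; field_simp
  have hρα : ρ * α ≤ 1 := by
    rw [hρ, div_mul_eq_mul_div, div_le_one (by positivity)]
    nlinarith [sq_nonneg M]
  choose P hP using fun a : H => hf.exists_mem_prox_smul (inv_pos.2 hρ0) a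
  have hPle : ∀ a b, ‖P a - P b‖ ≤ ‖a - b‖ := by
    intro a b
    have h := hf.norm_sub_le_of_mem_prox (α := ρ⁻¹) (A := fun y => ρ⁻¹ • y)
      (fun x₁ x₂ => by rw [← smul_sub, real_inner_smul_left, real_inner_self_eq_norm_sq])
      (hP a) (hP b)
    rw [← smul_sub, norm_smul, Real.norm_of_nonneg (inv_pos.2 hρ0).le] at h
    exact le_of_mul_le_mul_left h (inv_pos.2 hρ0)
  set T : H → H := fun y => P (y - ρ • (A y - x)) with hT
  have hcontr : ContractingWith (Real.toNNReal √(1 - ρ * α)) T := by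
    refine ⟨?_, LipschitzWith.of_dist_le_mul fun y₁ y₂ => ?_⟩
    · rw [Real.toNNReal_lt_one, Real.sqrt_lt' one_pos]
      nlinarith [mul_pos hρ0 hα]
    · rw [Real.coe_toNNReal _ (Real.sqrt_nonneg _), dist_eq_norm, dist_eq_norm]
      refine (hPle _ _).trans ?_
      rw [show y₁ - ρ • (A y₁ - x) - (y₂ - ρ • (A y₂ - x)) = (y₁ - y₂) - ρ • (A y₁ - A y₂) by
        module]
      rw [← Real.sqrt_sq (norm_nonneg (y₁ - y₂)), ← Real.sqrt_mul (by linarith)]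
      refine Real.le_sqrt_of_sq_le ?_
      rw [norm_sub_sq_real, norm_smul, inner_smul_right, Real.norm_of_nonneg hρ0.le, mul_pow,
        real_inner_comm]
      have h1 := hA y₂ y₁
      have h2 : ‖A y₁ - A y₂‖ ^ 2 ≤ M ^ 2 * ‖y₁ - y₂‖ ^ 2 := by
        rw [← mul_pow]
        exact pow_le_pow_left₀ (norm_nonneg _) (hM y₂ y₁) 2
      have h3 : ρ * (M ^ 2 * ‖y₁ - y₂‖ ^ 2) ≤ α * ‖y₁ - y₂‖ ^ 2 := by
        rw [← mul_assoc]
        refine mul_le_mul_of_nonneg_right ?_ (sq_nonneg _)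
        nlinarith [sq_nonneg α]
      have h4 := mul_le_mul_of_nonneg_left h1 hρ0.le
      have h5 := mul_le_mul_of_nonneg_left h2 (sq_nonneg ρ)
      have h6 := mul_le_mul_of_nonneg_left h3 hρ0.le
      linear_combination 2 * h4 + h5 + h6
  have hfix : T (hcontr.fixedPoint) = hcontr.fixedPoint := hcontr.fixedPoint_isFixedPt
  set y := hcontr.fixedPoint with hy
  have hPy := hP (y - ρ • (A y - x))
  rw [show P (y - ρ • (A y - x)) = y from hfix] at hPy
  obtain ⟨r, hr, h⟩ := hf.mem_prox_iff.1 hPy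
  refine ⟨y, hf.mem_prox_iff.2 ⟨r, hr, fun z s hzs => ?_⟩⟩
  have h1 := h z s hzs
  -- At a fixed point the residual `ρ⁻¹ • (y - ρ • (A y - x)) - ρ⁻¹ • y` is exactly `x - A y`.
  rwa [← smul_sub, sub_sub_cancel_left, smul_neg, inv_smul_smul₀ hρ0.ne', neg_sub] at h1

end Existence

/-! ### Comparison of set limits -/

section Limits

theorem PosToZero.comp {t : ℕ → ℝ≥0} (ht : PosToZero t) {φ : ℕ → ℕ} (hφ : Tendsto φ atTop atTop) :
    PosToZero (t ∘ φ) :=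
  ⟨fun n => ht.1 (φ n), ht.2.comp hφ⟩

theorem PosToZero.tendsto_nhdsGT {t : ℕ → ℝ≥0} (ht : PosToZero t) :
    Tendsto t atTop (𝓝[>] 0) :=
  tendsto_nhdsWithin_iff.2 ⟨ht.2, Eventually.of_forall ht.1⟩

theorem posToZero_one_div : PosToZero (fun n : ℕ => 1 / ((n : ℝ≥0) + 1)) :=
  ⟨fun n => by positivity, tendsto_one_div_add_atTop_nhds_zero_nat (𝕜 := ℝ≥0)⟩

theorem innerLimit_subset_outerLimit {X : Type*} [NormedAddCommGroup X] (S : ℝ≥0 → Set X) :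
    innerLimit S ⊆ outerLimit S := by
  intro x hx
  obtain ⟨u, hu, N, hN⟩ := hx _ posToZero_one_div
  exact ⟨_, posToZero_one_div.comp (tendsto_add_atTop_nat N), fun n => u (n + N),
    hu.comp (tendsto_add_atTop_nat N), fun n => hN _ (Nat.le_add_left _ _)⟩

theorem outerLimit_subset_weakOuterLimit {X : Type*} [NormedAddCommGroup X] [NormedSpace ℝ X]
    (S : ℝ≥0 → Set X) : outerLimit S ⊆ weakOuterLimit S := by
  rintro x ⟨t, ht, u, hu, h⟩
  exact ⟨t, ht, u, weakTendsto_of_forall_dual fun φ => (φ.continuous.tendsto x).comp hu, h⟩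

end Limits

/-! ### Stability of variational inequalities under Mosco convergence -/

section Variational

variable {H : Type*} [NormedAddCommGroup H] [InnerProductSpace ℝ H]

/-- A uniform linear minorant for a family of sets that are star-shaped at the origin. -/
theorem exists_uniform_linear_lower_bound {S : ℝ≥0 → Set (H × ℝ)}
    (hS : ∀ τ, 0 < τ → ∀ p ∈ S τ, ∀ l : ℝ, 0 ≤ l → l ≤ 1 → l • p ∈ S τ)
    (hup : ∀ τ, 0 < τ → ∀ u s s', (u, s) ∈ S τ → s ≤ s' → (u, s') ∈ S τ)
    {r : ℝ} (hr : ((0 : H), r) ∉ outerLimit S) {t : ℕ → ℝ≥0} (ht : PosToZero t) :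
    ∃ C : ℝ, 0 ≤ C ∧ ∀ᶠ n in atTop, ∀ u s, (u, s) ∈ S (t n) → -(C * (‖u‖ + 1)) ≤ s := by
  by_contra! hcon
  -- Violations with constant `(k + 1) ^ 2`, scaled by `1 / ((k + 1) * (‖u‖ + 1))`, have first
  -- component tending to `0` but height below `-(k + 1)`. Raising the height to `r` puts `(0, r)`
  -- in the outer limit.
  have h1 : ∀ k : ℕ, ∃ᶠ n in atTop, ∃ u s, (u, s) ∈ S (t n) ∧
      s < -(((k : ℝ) + 1) ^ 2 * (‖u‖ + 1)) := fun k => hcon _ (by positivity)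
  obtain ⟨φ, hφ, h⟩ := extraction_forall_of_frequently h1
  choose u s hus hlt using h
  -- Shifting the index by `K` makes every scaled height at most `r`.
  obtain ⟨K, hK⟩ := exists_nat_ge (-r)
  have hl : ∀ k : ℕ, 0 < 1 / (((k : ℝ) + 1) * (‖u k‖ + 1)) := fun k => by positivity
  refine hr ⟨_, ht.comp (hφ.tendsto_atTop.comp (tendsto_add_atTop_nat K)),
    fun k => ((1 / ((((k + K : ℕ) : ℝ) + 1) * (‖u (k + K)‖ + 1))) • u (k + K), r), ?_, ?_⟩
  · refine Tendsto.prodMk_nhds ?_ tendsto_const_nhds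
    refine Tendsto.comp (g := fun k : ℕ => (1 / (((k : ℝ) + 1) * (‖u k‖ + 1))) • u k) ?_
      (tendsto_add_atTop_nat K)
    refine squeeze_zero_norm (fun k => ?_) (tendsto_one_div_add_atTop_nhds_zero_nat (𝕜 := ℝ))
    rw [norm_smul, Real.norm_of_nonneg (hl k).le, div_mul_eq_mul_div,
      div_le_div_iff₀ (by positivity) (by positivity)]
    have : (0 : ℝ) ≤ (k : ℝ) + 1 := by positivity
    nlinarith
  · intro k
    have h2 := hS _ (ht.1 _) _ (hus (k + K)) _ (hl (k + K)).le (by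
      rw [div_le_one (by positivity)]
      nlinarith [norm_nonneg (u (k + K)), Nat.cast_nonneg (α := ℝ) (k + K)])
    refine hup _ (ht.1 _) _ _ _ h2 ?_
    have h3 := mul_le_mul_of_nonneg_left (hlt (k + K)).le (hl (k + K)).le
    rw [show 1 / ((((k + K : ℕ) : ℝ) + 1) * (‖u (k + K)‖ + 1)) *
      -((((k + K : ℕ) : ℝ) + 1) ^ 2 * (‖u (k + K)‖ + 1)) = -(((k + K : ℕ) : ℝ) + 1) by
        field_simp] at h3
    refine h3.trans ?_
    push_cast
    have : (0 : ℝ) ≤ k := by positivity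
    linarith

/-- For larger `a > 1` one would have `α * a ^ 2 > D * a + 2 * C * a ≥ D * a + C * (a + 1)`. -/
theorem exists_bound_of_variational {α C D a ρ : ℝ} (hα : 0 < α) (hC : 0 ≤ C) (hD : 0 ≤ D)
    (h₁ : -(C * (a + 1)) ≤ ρ) (h₂ : ρ ≤ D * a - α * a ^ 2) :
    a ≤ (D + 2 * C) / α + 1 := by
  by_contra! hlt
  have h3 : D + 2 * C < α * a := (div_lt_iff₀' hα).1 (by linarith)
  have h4 : 1 < a := by
    have : 0 ≤ (D + 2 * C) / α := by positivity
    linarith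
  nlinarith

variable [CompleteSpace H]

/-- Along a subsequence, solutions of the variational inequalities over Mosco converging epigraphs
converge strongly to the solution of the limit problem. -/
theorem exists_subseq_tendsto_of_variational {S : ℝ≥0 → Set (H × ℝ)}
    (hS : ∀ τ, 0 < τ → ∀ p ∈ S τ, ∀ l : ℝ, 0 ≤ l → l ≤ 1 → l • p ∈ S τ)
    (hup : ∀ τ, 0 < τ → ∀ u s s', (u, s) ∈ S τ → s ≤ s' → (u, s') ∈ S τ)
    (hzero : ∀ τ, 0 < τ → ((0 : H), (0 : ℝ)) ∈ S τ)
    {c : ℝ} (hc : ((0 : H), c) ∉ outerLimit S)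
    {B : ℝ≥0 → H → H} {B₀ : H → H} {α : ℝ} (hα : 0 < α)
    (hB : ∀ τ, 0 < τ → ∀ x₁ x₂, α * ‖x₂ - x₁‖ ^ 2 ≤ inner ℝ (B τ x₂ - B τ x₁) (x₂ - x₁))
    (hB₀ : ∀ u, Tendsto (fun p : ℝ≥0 × H => B p.1 p.2) (𝓝[>] 0 ×ˢ 𝓝 u) (𝓝 (B₀ u)))
    {w x : H} {r : ℝ} (hx : (x, r) ∈ innerLimit S)
    (hxr : ∀ u s, (u, s) ∈ weakOuterLimit S → r + inner ℝ (w - B₀ x) (u - x) ≤ s)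
    {t : ℕ → ℝ≥0} (ht : PosToZero t) {z : ℕ → H} {ρ : ℕ → ℝ} (hz : ∀ n, (z n, ρ n) ∈ S (t n))
    (hvar : ∀ n u s, (u, s) ∈ S (t n) → ρ n + inner ℝ (w - B (t n) (z n)) (u - z n) ≤ s) :
    ∃ φ : ℕ → ℕ, Tendsto (fun n => z (φ n)) atTop (𝓝 x) := by
  obtain ⟨C, hC, hCn⟩ := exists_uniform_linear_lower_bound hS hup hc ht
  set D : ℝ := ‖w - B₀ 0‖ + 1 with hD
  have hD0 : 0 ≤ D := by positivity
  have hDn : ∀ᶠ n in atTop, ‖w - B (t n) 0‖ ≤ D := by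
    have h1 : Tendsto (fun n => B (t n) 0) atTop (𝓝 (B₀ 0)) :=
      (hB₀ 0).comp (ht.tendsto_nhdsGT.prodMk tendsto_const_nhds)
    exact ((h1.const_sub w).norm.eventually_lt_const (lt_add_one _)).mono fun n hn => hn.le
  obtain ⟨N, hN⟩ := eventually_atTop.1 (hCn.and hDn)
  have hupper : ∀ n ≥ N, ρ n ≤ D * ‖z n‖ - α * ‖z n‖ ^ 2 := by
    intro n hn
    -- Testing at the origin, where the height `0` is available, gives the upper bound on `ρ n`.
    have h1 := hvar n 0 0 (hzero _ (ht.1 n))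
    have h2 := hB _ (ht.1 n) 0 (z n)
    have h3 := (real_inner_le_norm (w - B (t n) 0) (z n)).trans
      (mul_le_mul_of_nonneg_right (hN n hn).2 (norm_nonneg _))
    rw [zero_sub, inner_neg_right, inner_sub_left] at h1
    rw [sub_zero, inner_sub_left] at h2
    rw [inner_sub_left] at h3
    linarith
  set R : ℝ := (D + 2 * C) / α + 1 with hR
  have hzR : ∀ n ≥ N, ‖z n‖ ≤ R := fun n hn =>
    exists_bound_of_variational hα hC hD0 ((hN n hn).1 _ _ (hz n)) (hupper n hn)
  have hρ : ∀ n, ρ (n + N) ∈ Set.Icc (-(C * (R + 1))) (D * R) := by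
    intro n
    have hn : n + N ≥ N := Nat.le_add_left _ _
    have h1 := (hN _ hn).1 _ _ (hz (n + N))
    have h2 := mul_le_mul_of_nonneg_left (hzR _ hn) hC
    have h3 := mul_le_mul_of_nonneg_left (hzR _ hn) hD0
    have h4 := hupper _ hn
    have h5 : 0 ≤ α * ‖z (n + N)‖ ^ 2 := by positivity
    constructor <;> linarith
  obtain ⟨x', φ₁, hφ₁, hx'⟩ := exists_subseq_inner_tendsto (z := fun n => z (n + N))
    (fun n => hzR _ (Nat.le_add_left _ _))
  obtain ⟨r', -, φ₂, hφ₂, hr'⟩ := isCompact_Icc.tendsto_subseq (fun n => hρ (φ₁ n))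
  set ψ : ℕ → ℕ := fun n => φ₁ (φ₂ n) + N with hψ
  have hψt : Tendsto ψ atTop atTop :=
    (tendsto_add_atTop_nat N).comp (hφ₁.tendsto_atTop.comp hφ₂.tendsto_atTop)
  have hweak : ∀ y, Tendsto (fun n => inner ℝ y (z (ψ n))) atTop (𝓝 (inner ℝ y x')) :=
    fun y => (hx' y).comp hφ₂.tendsto_atTop
  have hρψ : Tendsto (fun n => ρ (ψ n)) atTop (𝓝 r') := hr'
  have hmem : (x', r') ∈ weakOuterLimit S :=
    ⟨_, ht.comp hψt, fun n => (z (ψ n), ρ (ψ n)), weakTendsto_prodMk hweak hρψ, fun n => hz _⟩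
  obtain ⟨u, hu, N', hu'⟩ := hx _ (ht.comp hψt)
  have hu1 : Tendsto (fun n => (u n).1) atTop (𝓝 x) := (continuous_fst.tendsto _).comp hu
  have hu2 : Tendsto (fun n => (u n).2) atTop (𝓝 r) := (continuous_snd.tendsto _).comp hu
  have hBu : Tendsto (fun n => w - B (t (ψ n)) (u n).1) atTop (𝓝 (w - B₀ x)) :=
    ((hB₀ x).comp ((ht.comp hψt).tendsto_nhdsGT.prodMk hu1)).const_sub w
  -- An upper bound for `α * ‖(u n).1 - z (ψ n)‖ ^ 2`. Strong monotonicity moves `B` from `z (ψ n)`,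
  -- known to converge only weakly, to the strongly convergent `(u n).1`, so that `hB₀` applies.
  set e : ℕ → ℝ := fun n => (u n).2 - ρ (ψ n)
    - inner ℝ (w - B (t (ψ n)) (u n).1) ((u n).1 - z (ψ n)) with he
  have hlim : Tendsto e atTop (𝓝 (r - r' - inner ℝ (w - B₀ x) (x - x'))) := by
    refine (hu2.sub hρψ).sub ?_
    simp only [inner_sub_right]
    exact (hBu.inner hu1).sub
      (tendsto_inner_of_weak (fun n => hzR _ (Nat.le_add_left _ _)) hweak hBu)
  have hle : ∀ᶠ n in atTop, α * ‖(u n).1 - z (ψ n)‖ ^ 2 ≤ e n := by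
    filter_upwards [eventually_ge_atTop N'] with n hn
    have h1 := hvar (ψ n) (u n).1 (u n).2 (hu' n hn)
    have h2 := hB _ (ht.1 (ψ n)) (z (ψ n)) (u n).1
    simp only [he, inner_sub_left] at h1 h2 ⊢
    linarith
  -- Nonnegative as a limit of upper bounds for squares; nonpositive by the limit inequality tested
  -- at `(x', r')`.
  have hlim0 : r - r' - inner ℝ (w - B₀ x) (x - x') = 0 := by
    refine le_antisymm ?_ (ge_of_tendsto hlim (hle.mono fun n hn => le_trans (by positivity) hn))
    have h1 := hxr _ _ hmem
    rw [← neg_sub x x', inner_neg_right] at h1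
    linarith
  rw [hlim0] at hlim
  have h1 : Tendsto (fun n => ‖(u n).1 - z (ψ n)‖ ^ 2) atTop (𝓝 0) := by
    have h2 : Tendsto (fun n => α⁻¹ * e n) atTop (𝓝 0) := by simpa using hlim.const_mul α⁻¹
    refine squeeze_zero' (Eventually.of_forall fun n => by positivity) ?_ h2
    filter_upwards [hle] with n hn
    rwa [← div_eq_inv_mul, le_div_iff₀' hα]
  have h2 : Tendsto (fun n => (u n).1 - z (ψ n)) atTop (𝓝 0) := by
    rw [tendsto_zero_iff_norm_tendsto_zero]
    simpa using h1.sqrt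
  exact ⟨ψ, by simpa using hu1.sub h2⟩

end Variational

/-! ### Difference quotients of `A`, `f` and `Prox` -/

section Quotients

variable {H : Type*} [NormedAddCommGroup H] [InnerProductSpace ℝ H]

theorem secondQuot_le_iff {f : ℝ≥0 → H → EReal} {τ : ℝ≥0} (hf : ∀ x, f τ x ≠ ⊥) (hτ : 0 < τ)
    {v v₀ : H} {r : ℝ} (hr : f τ v = r) {w : H} {s : ℝ} :
    secondQuot f v v₀ τ w ≤ s ↔
      f τ (v + (τ : ℝ) • w) ≤ ((r + (τ : ℝ) * inner ℝ v₀ w + (τ : ℝ) ^ 2 * s : ℝ) : EReal) := by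
  have hτ2 : (0 : ℝ) < (τ : ℝ) ^ 2 := by positivity
  unfold secondQuot
  rw [hr]
  by_cases htop : f τ (v + (τ : ℝ) • w) = ⊤
  · rw [htop, EReal.top_sub_coe, EReal.top_sub_coe,
      EReal.top_div_of_pos_ne_top (by exact_mod_cast hτ2) (EReal.coe_ne_top _)]
    simp [-EReal.coe_add]
  · rw [← EReal.coe_toReal htop (hf _), ← EReal.coe_sub, ← EReal.coe_sub, ← EReal.coe_div,
      EReal.coe_le_coe_iff, EReal.coe_le_coe_iff, div_le_iff₀ hτ2]
    constructor <;> intro h <;> linarith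

/-- The epigraph of the quotient corresponds affinely to that of `f τ`, with the origin matching
`(v, f τ v)`; scaling is a convex combination with that point. -/
theorem smul_mem_epi_secondQuot {f : ℝ≥0 → H → EReal} {τ : ℝ≥0} (hf : IsGamma0 (f τ)) (hτ : 0 < τ)
    {v v₀ : H} {r : ℝ} (hr : f τ v = r) {p : H × ℝ} (hp : p ∈ epi (secondQuot f v v₀ τ)) {l : ℝ}
    (hl : 0 ≤ l) (hl1 : l ≤ 1) : l • p ∈ epi (secondQuot f v v₀ τ) := by
  have h1 := (secondQuot_le_iff hf.ne_bot hτ hr).1 (show secondQuot f v v₀ τ p.1 ≤ p.2 from hp)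
  refine (secondQuot_le_iff hf.ne_bot hτ hr).2 ?_
  have h2 : f τ _ ≤ _ := hf.convex (show (v, r) ∈ epi (f τ) from hr.le)
    (show (_, _) ∈ epi (f τ) from h1) (sub_nonneg.2 hl1) hl (by ring)
  convert h2 using 2
  · simp only [Prod.fst_add, Prod.smul_fst]
    module
  · simp only [Prod.snd_add, Prod.smul_snd, Prod.smul_fst, smul_eq_mul, inner_smul_right]
    ring

theorem mem_protoQuot_iff {B : ℝ≥0 → H → Set H} {τ : ℝ≥0} (hτ : 0 < τ) {x v w z : H} :
    z ∈ protoQuot B x v τ w ↔ v + (τ : ℝ) • z ∈ B τ (x + (τ : ℝ) • w) := by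
  have hτ' : (τ : ℝ) ≠ 0 := by exact_mod_cast hτ.ne'
  constructor
  · rintro ⟨y, hy, rfl⟩
    simpa [smul_inv_smul₀ hτ'] using hy
  · intro h
    exact ⟨_, h, by simp [inv_smul_smul₀ hτ']⟩

/-- Substitute `v + τ • z` in the inequality defining `Prox`, subtract the part linear in `x - A 0
v`, and divide by `τ ^ 2`. -/
theorem exists_variational_of_mem_protoQuot {A : ℝ≥0 → H → H} {f : ℝ≥0 → H → EReal} {τ : ℝ≥0}
    (hf : IsGamma0 (f τ)) (hτ : 0 < τ) {x v : H} {r : ℝ} (hr : f τ v = r) {w z : H}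
    (hz : z ∈ protoQuot (Prox A f) x v τ w) :
    ∃ ρ : ℝ, (z, ρ) ∈ epi (secondQuot f v (x - A 0 v) τ) ∧
      ∀ u s, (u, s) ∈ epi (secondQuot f v (x - A 0 v) τ) →
        ρ + inner ℝ (w - semiQuot A v (τ, z)) (u - z) ≤ s := by
  have hτ' : (τ : ℝ) ≠ 0 := by exact_mod_cast hτ.ne'
  have hτ2 : (0 : ℝ) < (τ : ℝ) ^ 2 := by positivity
  obtain ⟨q, hq, h⟩ := hf.mem_prox_iff.1 ((mem_protoQuot_iff hτ).1 hz)
  refine ⟨(q - r - τ * inner ℝ (x - A 0 v) z) / (τ : ℝ) ^ 2, ?_, fun u s hus => ?_⟩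
  · refine (secondQuot_le_iff hf.ne_bot hτ hr).2 (hq.le.trans (EReal.coe_le_coe_iff.2 ?_))
    rw [mul_div_cancel₀ _ hτ2.ne']
    linarith
  · have h1 := h _ _ ((secondQuot_le_iff hf.ne_bot hτ hr).1 hus)
    have h2 : x + (τ : ℝ) • w - A τ (v + (τ : ℝ) • z)
        = (x - A 0 v) + (τ : ℝ) • (w - semiQuot A v (τ, z)) := by
      simp only [semiQuot, smul_sub, smul_inv_smul₀ hτ']
      abel
    rw [h2, show v + (τ : ℝ) • u - (v + (τ : ℝ) • z) = (τ : ℝ) • (u - z) by module,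
      inner_smul_right, inner_add_left, real_inner_smul_left, inner_sub_right] at h1
    refine le_of_mul_le_mul_left ?_ hτ2
    rw [mul_add, mul_div_cancel₀ _ hτ2.ne']
    linear_combination h1

theorem norm_sub_le_of_mem_protoQuot {A : ℝ≥0 → H → H} {f : ℝ≥0 → H → EReal} {τ : ℝ≥0}
    (hf : IsGamma0 (f τ)) (hτ : 0 < τ) {α : ℝ}
    (hA : ∀ x₁ x₂, α * ‖x₂ - x₁‖ ^ 2 ≤ inner ℝ (A τ x₂ - A τ x₁) (x₂ - x₁))
    {x v w₁ w₂ z₁ z₂ : H} (h₁ : z₁ ∈ protoQuot (Prox A f) x v τ w₁)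
    (h₂ : z₂ ∈ protoQuot (Prox A f) x v τ w₂) : α * ‖z₁ - z₂‖ ≤ ‖w₁ - w₂‖ := by
  have h := hf.norm_sub_le_of_mem_prox hA ((mem_protoQuot_iff hτ).1 h₁)
    ((mem_protoQuot_iff hτ).1 h₂)
  have hτ' : (0 : ℝ) < τ := by exact_mod_cast hτ
  rw [add_sub_add_left_eq_sub, add_sub_add_left_eq_sub, ← smul_sub, ← smul_sub, norm_smul,
    norm_smul, Real.norm_of_nonneg hτ'.le] at h
  exact le_of_mul_le_mul_left (by linarith) hτ'

theorem semiQuot_sub {A : ℝ≥0 → H → H} (v : H) (τ : ℝ≥0) (x₁ x₂ : H) :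
    semiQuot A v (τ, x₂) - semiQuot A v (τ, x₁)
      = (τ : ℝ)⁻¹ • (A τ (v + (τ : ℝ) • x₂) - A τ (v + (τ : ℝ) • x₁)) := by
  simp only [semiQuot]
  module

theorem norm_semiQuot_sub_le {A : ℝ≥0 → H → H} {τ : ℝ≥0} (hτ : 0 < τ) {M : ℝ}
    (hA : ∀ x₁ x₂, ‖A τ x₂ - A τ x₁‖ ≤ M * ‖x₂ - x₁‖) (v x₁ x₂ : H) :
    ‖semiQuot A v (τ, x₂) - semiQuot A v (τ, x₁)‖ ≤ M * ‖x₂ - x₁‖ := by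
  have hτ' : (0 : ℝ) < τ := by exact_mod_cast hτ
  have h := hA (v + (τ : ℝ) • x₁) (v + (τ : ℝ) • x₂)
  rw [add_sub_add_left_eq_sub, ← smul_sub, norm_smul, Real.norm_of_nonneg hτ'.le] at h
  rw [semiQuot_sub, norm_smul, Real.norm_of_nonneg (inv_nonneg.2 hτ'.le), ← div_eq_inv_mul,
    div_le_iff₀ hτ']
  linarith

theorem le_inner_semiQuot_sub {A : ℝ≥0 → H → H} {τ : ℝ≥0} (hτ : 0 < τ) {α : ℝ}
    (hA : ∀ x₁ x₂, α * ‖x₂ - x₁‖ ^ 2 ≤ inner ℝ (A τ x₂ - A τ x₁) (x₂ - x₁)) (v x₁ x₂ : H) :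
    α * ‖x₂ - x₁‖ ^ 2 ≤ inner ℝ (semiQuot A v (τ, x₂) - semiQuot A v (τ, x₁)) (x₂ - x₁) := by
  have hτ' : (0 : ℝ) < τ := by exact_mod_cast hτ
  have h := hA (v + (τ : ℝ) • x₁) (v + (τ : ℝ) • x₂)
  rw [add_sub_add_left_eq_sub, ← smul_sub, norm_smul, Real.norm_of_nonneg hτ'.le, inner_smul_right,
    mul_pow] at h
  rw [semiQuot_sub, real_inner_smul_left, ← div_eq_inv_mul, le_div_iff₀ hτ']
  refine le_of_mul_le_mul_left ?_ hτ'
  linarith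

theorem SemiDifferentiableAt.tendsto {A : ℝ≥0 → H → H} {v : H} (h : SemiDifferentiableAt A v)
    (w : H) : Tendsto (semiQuot A v) (𝓝[>] 0 ×ˢ 𝓝 w) (𝓝 (semiDeriv A v w)) :=
  tendsto_nhds_limUnder (h w)

theorem SemiDifferentiableAt.tendsto_right {A : ℝ≥0 → H → H} {v : H}
    (h : SemiDifferentiableAt A v) (w : H) :
    Tendsto (fun τ => semiQuot A v (τ, w)) (𝓝[>] 0) (𝓝 (semiDeriv A v w)) :=
  (h.tendsto w).comp (tendsto_id.prodMk tendsto_const_nhds)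

theorem SemiDifferentiableAt.norm_semiDeriv_sub_le {A : ℝ≥0 → H → H} {v : H}
    (h : SemiDifferentiableAt A v) {M : ℝ}
    (hA : ∀ t x₁ x₂, ‖A t x₂ - A t x₁‖ ≤ M * ‖x₂ - x₁‖) (x₁ x₂ : H) :
    ‖semiDeriv A v x₂ - semiDeriv A v x₁‖ ≤ M * ‖x₂ - x₁‖ := by
  refine le_of_tendsto ((h.tendsto_right x₂).sub (h.tendsto_right x₁)).norm ?_
  filter_upwards [self_mem_nhdsWithin] with τ hτ using norm_semiQuot_sub_le hτ (hA τ) v x₁ x₂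

theorem SemiDifferentiableAt.le_inner_semiDeriv_sub {A : ℝ≥0 → H → H} {v : H}
    (h : SemiDifferentiableAt A v) {α : ℝ}
    (hA : ∀ t x₁ x₂, α * ‖x₂ - x₁‖ ^ 2 ≤ inner ℝ (A t x₂ - A t x₁) (x₂ - x₁)) (x₁ x₂ : H) :
    α * ‖x₂ - x₁‖ ^ 2 ≤ inner ℝ (semiDeriv A v x₂ - semiDeriv A v x₁) (x₂ - x₁) := by
  refine ge_of_tendsto
    (((h.tendsto_right x₂).sub (h.tendsto_right x₁)).inner tendsto_const_nhds) ?_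
  filter_upwards [self_mem_nhdsWithin] with τ hτ using le_inner_semiQuot_sub hτ (hA τ) v x₁ x₂

/-- The difference quotients of `Prox_{A,f}` converge pointwise to
`prox_{D_s A(v), d²_e f(v|v₀)}`. -/
theorem tendsto_of_mem_protoQuot_Prox [CompleteSpace H] {A : ℝ≥0 → H → H} {f : ℝ≥0 → H → EReal}
    {α : ℝ} (hα : 0 < α)
    (hA : ∀ t x₁ x₂, α * ‖x₂ - x₁‖ ^ 2 ≤ inner ℝ (A t x₂ - A t x₁) (x₂ - x₁))
    (hf : IsParamGamma0 f) {x v : H} (hsemi : SemiDifferentiableAt A v)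
    (hepi : TwiceEpiDifferentiableAt f v (x - A 0 v))
    (hg : IsGamma0 (secondEpiDeriv f v (x - A 0 v))) {w z : H}
    (hz : z ∈ prox (semiDeriv A v) (secondEpiDeriv f v (x - A 0 v)) w)
    {t : ℕ → ℝ≥0} (ht : PosToZero t) {y : ℕ → H}
    (hy : ∀ n, y n ∈ protoQuot (Prox A f) x v (t n) w) : Tendsto y atTop (𝓝 z) := by
  choose r hr using hepi.1
  have hmosco := hepi.2.2
  have hE : epi (secondEpiDeriv f v (x - A 0 v))
      = innerLimit fun τ => epi (secondQuot f v (x - A 0 v) τ) := epi_eLim _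
  -- Otherwise the second epi-derivative would be `⊥` at `0`, which `hg` excludes.
  obtain ⟨c, hc⟩ : ∃ c : ℝ, ((0 : H), c) ∉
      outerLimit fun τ => epi (secondQuot f v (x - A 0 v) τ) := by
    by_contra! hcon
    refine hg.ne_bot 0 ((EReal.eq_bot_iff_forall_lt _).2 fun b => ?_)
    have h1 : ((0 : H), b - 1) ∈ epi (secondEpiDeriv f v (x - A 0 v)) := by
      rw [hE]
      exact hmosco (outerLimit_subset_weakOuterLimit _ (hcon (b - 1)))
    exact lt_of_le_of_lt h1 (EReal.coe_lt_coe_iff.2 (by linarith))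
  obtain ⟨q, hq, hvar⟩ := hg.mem_prox_iff.1 hz
  choose ρ hρ hρ' using fun n =>
    exists_variational_of_mem_protoQuot (hf (t n)) (ht.1 n) (hr (t n)) (hy n)
  refine tendsto_of_subseq_tendsto fun φ hφ => ?_
  refine exists_subseq_tendsto_of_variational (S := fun τ => epi (secondQuot f v (x - A 0 v) τ))
    (B := fun τ u => semiQuot A v (τ, u)) (B₀ := semiDeriv A v) (w := w) (r := q)
    (fun τ hτ p hp l hl hl1 => smul_mem_epi_secondQuot (hf τ) hτ (hr τ) hp hl hl1)
    (fun τ hτ u s s' hus hs => le_trans (show _ ≤ (s : EReal) from hus)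
      (EReal.coe_le_coe_iff.2 hs))
    (fun τ hτ => ?_) hc hα (fun τ hτ => le_inner_semiQuot_sub hτ (hA τ) v) hsemi.tendsto
    ?_ ?_ (ht.comp hφ) (fun n => hρ (φ n)) (fun n => hρ' (φ n))
  · refine (secondQuot_le_iff (hf τ).ne_bot hτ (hr τ)).2 ?_
    simp [hr τ]
  · rw [← hE]
    exact hq.le
  · intro u s hus
    refine hvar u s ?_
    have h1 := hmosco hus
    rw [← hE] at h1
    exact h1

end Quotients

end SensVI

/-! ### Proto-differentiability of `Prox` -/

theorem mainTheorem2 {H : Type*} [NormedAddCommGroup H] [InnerProductSpace ℝ H] [CompleteSpace H]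
    (A : ℝ≥0 → H → H) (f : ℝ≥0 → H → EReal)
    (hA_lip : UniformlyLipschitz A) (hA_mono : UniformlyStronglyMonotone A)
    (hf : IsParamGamma0 f) :
    (∀ t x, ∃! y, y ∈ Prox A f t x) ∧
    ∀ x v : H, v ∈ Prox A f 0 x →
      SemiDifferentiableAt A v →
      TwiceEpiDifferentiableAt f v (x - A 0 v) →
      IsGamma0 (secondEpiDeriv f v (x - A 0 v)) →
      ProtoDifferentiableAt (Prox A f) x v ∧
      protoDeriv (Prox A f) x v = prox (semiDeriv A v) (secondEpiDeriv f v (x - A 0 v)) ∧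
      ∀ w, ∃! z, z ∈ prox (semiDeriv A v) (secondEpiDeriv f v (x - A 0 v)) w := by
  obtain ⟨M, -, hM⟩ := hA_lip
  obtain ⟨α, hα, hA⟩ := hA_mono
  have hProx : ∀ t x, ∃! y, y ∈ Prox A f t x := fun t x =>
    (hf t).existsUnique_mem_prox (hM t) hα (hA t) x
  refine ⟨hProx, fun x v hv hsemi hepi hg => ?_⟩
  have hlim : ∀ w, ∃! z, z ∈ prox (semiDeriv A v) (secondEpiDeriv f v (x - A 0 v)) w := fun w =>
    hg.existsUnique_mem_prox (hsemi.norm_semiDeriv_sub_le hM) hα (hsemi.le_inner_semiDeriv_sub hA) w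
  have hquot : ∀ (t : ℕ → ℝ≥0) w, ∃ y : ℕ → H,
      ∀ n, y n ∈ protoQuot (Prox A f) x v (t n) w := by
    intro t w
    choose y hy using fun n => (hProx (t n) (x + (t n : ℝ) • w)).exists
    exact ⟨_, fun n => ⟨y n, hy n, rfl⟩⟩
  have hinner : ∀ w z, z ∈ prox (semiDeriv A v) (secondEpiDeriv f v (x - A 0 v)) w →
      (w, z) ∈ innerLimit fun τ => graph (protoQuot (Prox A f) x v τ) := by
    intro w z hz t ht
    obtain ⟨y, hy⟩ := hquot t w
    exact ⟨fun n => (w, y n), tendsto_const_nhds.prodMk_nhds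
      (tendsto_of_mem_protoQuot_Prox hα hA hf hsemi hepi hg hz ht hy), 0, fun n _ => hy n⟩
  have houter : ∀ w z, (w, z) ∈ (outerLimit fun τ => graph (protoQuot (Prox A f) x v τ)) →
      z ∈ prox (semiDeriv A v) (secondEpiDeriv f v (x - A 0 v)) w := by
    rintro w z ⟨t, ht, u, hu, hmem⟩
    obtain ⟨y, hy⟩ := hquot t w
    obtain ⟨z', hz', -⟩ := hlim w
    have hyz := tendsto_of_mem_protoQuot_Prox hα hA hf hsemi hepi hg hz' ht hy
    have hu1 : Tendsto (fun n => (u n).1) atTop (𝓝 w) := (continuous_fst.tendsto _).comp hu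
    have hu2 : Tendsto (fun n => (u n).2) atTop (𝓝 z) := (continuous_snd.tendsto _).comp hu
    -- The uniform `1/α`-Lipschitz bound compares values at the moving argument `(u n).1` with
    -- values at the fixed `w`.
    have hdiff : Tendsto (fun n => (u n).2 - y n) atTop (𝓝 0) := by
      have h1 : Tendsto (fun n => α⁻¹ * ‖(u n).1 - w‖) atTop (𝓝 0) := by
        simpa using (tendsto_iff_norm_sub_tendsto_zero.1 hu1).const_mul α⁻¹
      refine squeeze_zero_norm (fun n => ?_) h1
      rw [← div_eq_inv_mul, le_div_iff₀' hα]
      exact norm_sub_le_of_mem_protoQuot (hf (t n)) (ht.1 n) (hA (t n)) (hmem n) (hy n)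
    have hzz : z = z' := by
      refine tendsto_nhds_unique hu2 ?_
      simpa using hdiff.add hyz
    rwa [hzz]
  refine ⟨⟨hv, fun p hp => hinner p.1 p.2 (houter p.1 p.2 hp)⟩, ?_, hlim⟩
  funext w
  ext z
  exact ⟨fun h => houter w z (innerLimit_subset_outerLimit _ h), hinner w z⟩
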